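/- Let $\mathscr H$ be a (real or complex) Hilbert space with scalar field $\mathbb K$ and let $H$ be a Hermitian, possibly unbounded, operator on $\mathscr H$ with spectral resolution $P$: $P$ is a projection-valued measure on the Borel sets of $\mathbb R$, $H=\int\lambda\,dP(\lambda)$, and $D(H)=\{x:\int\lambda^2\,d\langle x,P(\lambda)x\rangle<\infty\}$. Point and continuous spectrum may be mixed. Let $v_1,\dots,v_M\in D(H)$ be guess vectors and $V=[v_1,\dots,v_M]:\mathbb K^M\to\mathscr H$. For a Borel set $I\subset\mathbb R$ let $V I=P(I)V$. For $W=[w_1,\dots,w_M]$ with $w_l\in D(H)$ write $W^2=W^\dagger W$ for the Gram matrix, $\lambda_{m^*}(W^2)$ for its smallest non-zero eigenvalue, and $\mu_1(W)\ge\dots\ge\mu_m(W)$, $m=\operatorname{rank}W^2$, for the proper eigenvalues, with multiplicity, of the generalized eigenvalue problem $W^\dagger HWx=\mu\,W^\dagger Wx$, that is, those with eigenvectors outside $\ker W$ (there is a system of $m$ generalized eigenvectors $x_i$ with $\langle x_i,W^2x_j\rangle=\delta_{ij}$). The spectral measure $|\alpha(E)|^2dE$ is the measure $I\mapsto\operatorname{Tr}[(VI)^2]=\sum_l\|P(I)v_l\|^2$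 on $\mathbb R$; it may have atoms. Put $$\lambda_{m^*}^\uparrow(V^2)(E)=\lambda_{m^*}\big((V(-\infty,E])^2\big),\qquad \lambda_{m^*}^\downarrow(V^2)(E)=\lambda_{m^*}\big((V[E,\infty))^2\big).$$ Suppose that $(H,V)$ is a signal to the interval $(E_a,E_b)$, that is, $$\int_{[E_b,\infty)}\frac{|\alpha(E)|^2}{\lambda_{m^*}^\uparrow(V^2)(E)}\,dE\le1\quad\text{and}\quad\int_{(-\infty,E_a]}\frac{|\alpha(E)|^2}{\lambda_{m^*}^\downarrow(V^2)(E)}\,dE\le1,$$ and let $B=V(E_a,E_b)$. Then for all $i\in\{1,\dots,\operatorname{rank}B^2\}$ the following integrals converge absolutely and $$\mu_i(V)-\mu_i(B)\le\int_{[E_b,\infty)}\frac{|\alpha(E)|^2}{\lambda_{m^*}^\uparrow(V^2)(E)}\,(E-\mu_i(B))\,dE,$$ $$\mu_i(V)-\mu_i(B)\ge\int_{(-\infty,E_a]}\frac{|\alpha(E)|^2}{\lambda_{m^*}^\downarrow(V^2)(E)}\,(E-\mu_i(B))\,dE.$$ -/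

import Mathlib

open MeasureTheory

/-- A projection-valued measure on the Borel sets of `ℝ`: orthogonal projections, multiplicative
on intersections, equal to the identity on `ℝ`, and strongly countably additive. -/
structure ProjectionValuedMeasure (𝕜 E : Type*) [RCLike 𝕜] [NormedAddCommGroup E]
    [InnerProductSpace 𝕜 E] [CompleteSpace E] where
  proj : Set ℝ → E →L[𝕜] E
  isStarProjection : ∀ s, MeasurableSet s → IsStarProjection (proj s)
  proj_univ : proj Set.univ = 1
  proj_inter : ∀ s t, MeasurableSet s → MeasurableSet t → proj (s ∩ t) = proj s * proj t
  hasSum_iUnion : ∀ f : ℕ → Set ℝ, (∀ n, MeasurableSet (f n)) →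
    Pairwise (Function.onFun Disjoint f) →
      ∀ x, HasSum (fun n => proj (f n) x) (proj (⋃ n, f n) x)

namespace ProjectionValuedMeasure

variable {𝕜 E : Type*} [RCLike 𝕜] [NormedAddCommGroup E] [InnerProductSpace 𝕜 E]
  [CompleteSpace E] (P : ProjectionValuedMeasure 𝕜 E)

theorem proj_empty : P.proj ∅ = 0 := by
  ext x
  have h := P.hasSum_iUnion (fun _ => ∅) (fun _ => MeasurableSet.empty)
    (fun _ _ _ => by simp [Function.onFun]) x
  exact (summable_const_iff _).1 h.summable

theorem re_inner_proj {s : Set ℝ} (hs : MeasurableSet s) (x : E) :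
    RCLike.re (inner 𝕜 x (P.proj s x)) = ‖P.proj s x‖ ^ 2 := by
  have h1 := (P.isStarProjection s hs).isIdempotentElem
  have h2 := (P.isStarProjection s hs).isSelfAdjoint
  have h3 : P.proj s x = P.proj s (P.proj s x) := by
    conv_lhs => rw [← h1.eq]
    rfl
  rw [h3, ← ContinuousLinearMap.adjoint_inner_left, ← ContinuousLinearMap.star_eq_adjoint,
    h2.star_eq, ← h3, inner_self_eq_norm_sq]

theorem hasSum_norm_sq {f : ℕ → Set ℝ} (hf : ∀ n, MeasurableSet (f n))
    (hd : Pairwise (Function.onFun Disjoint f)) (x : E) :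
    HasSum (fun n => ‖P.proj (f n) x‖ ^ 2) (‖P.proj (⋃ n, f n) x‖ ^ 2) := by
  have h := (P.hasSum_iUnion f hf hd x).mapL (innerSL 𝕜 x)
  have h' := h.mapL (RCLike.reCLM (K := 𝕜))
  rw [← P.re_inner_proj (MeasurableSet.iUnion hf)]
  simpa [← P.re_inner_proj (hf _)] using h'

/-- The scalar measure `s ↦ ⟨x, P(s) x⟩ = ‖P(s) x‖²` of a vector `x`. -/
noncomputable def scalarMeasure (x : E) : Measure ℝ :=
  Measure.ofMeasurable (fun s _ => ENNReal.ofReal (‖P.proj s x‖ ^ 2))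
    (by simp [P.proj_empty])
    (fun f hf hd => by
      have h := P.hasSum_norm_sq hf hd x
      rw [← h.tsum_eq, ENNReal.ofReal_tsum_of_nonneg (fun _ => by positivity) h.summable])

theorem scalarMeasure_apply {s : Set ℝ} (hs : MeasurableSet s) (x : E) :
    P.scalarMeasure x s = ENNReal.ofReal (‖P.proj s x‖ ^ 2) :=
  Measure.ofMeasurable_apply s hs

theorem scalarMeasure_proj {I : Set ℝ} (hI : MeasurableSet I) (x : E) :
    P.scalarMeasure (P.proj I x) = (P.scalarMeasure x).restrict I := by
  ext s hs
  rw [P.scalarMeasure_apply hs, Measure.restrict_apply hs, P.scalarMeasure_apply (hs.inter hI),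
    P.proj_inter s I hs hI]
  rfl

end ProjectionValuedMeasure

/-- The (possibly unbounded, everywhere or partially defined) operator `H` is Hermitian and has the
spectral resolution `P`, that is, `H = ∫ λ dP(λ)` with domain `{x | ∫ λ² d⟨x, P(λ) x⟩ < ∞}`.
Point and continuous spectrum may be mixed arbitrarily. -/
structure IsSpectralResolution {𝕜 E : Type*} [RCLike 𝕜] [NormedAddCommGroup E]
    [InnerProductSpace 𝕜 E] [CompleteSpace E] (H : E →ₗ.[𝕜] E)
    (P : ProjectionValuedMeasure 𝕜 E) : Prop where
  hermitian : H.IsFormalAdjoint H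
  mem_domain_iff : ∀ x : E, x ∈ H.domain ↔ Integrable (fun t : ℝ => t ^ 2) (P.scalarMeasure x)
  inner_apply : ∀ x : H.domain,
    inner 𝕜 (x : E) (H x) = ((∫ t, t ∂P.scalarMeasure (x : E) : ℝ) : 𝕜)

section GEP

variable {𝕜 E : Type*} [RCLike 𝕜] [NormedAddCommGroup E] [InnerProductSpace 𝕜 E]
  [CompleteSpace E] {M : ℕ}

theorem IsSpectralResolution.proj_mem_domain {H : E →ₗ.[𝕜] E} {P : ProjectionValuedMeasure 𝕜 E}
    (hP : IsSpectralResolution H P) {I : Set ℝ} (hI : MeasurableSet I) (x : H.domain) :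
    P.proj I (x : E) ∈ H.domain := by
  rw [hP.mem_domain_iff, P.scalarMeasure_proj hI]
  exact ((hP.mem_domain_iff _).1 x.2).restrict

/-- The projected guess vectors `V I = P(I) V`. -/
def projectedGuess {H : E →ₗ.[𝕜] E} {P : ProjectionValuedMeasure 𝕜 E}
    (hP : IsSpectralResolution H P) (v : Fin M → H.domain) (I : Set ℝ) (hI : MeasurableSet I) :
    Fin M → H.domain :=
  fun l => ⟨P.proj I (v l : E), hP.proj_mem_domain hI (v l)⟩

/-- The Gram matrix `V² = V† V`, with entries `⟨v_i, v_j⟩`. -/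
def gramMatrix {H : E →ₗ.[𝕜] E} (v : Fin M → H.domain) : Matrix (Fin M) (Fin M) 𝕜 :=
  Matrix.gram 𝕜 (fun l => (v l : E))

/-- The matrix `H_V = V† H V`, with entries `⟨v_i, H v_j⟩`. -/
def projectedMatrix (H : E →ₗ.[𝕜] E) (v : Fin M → H.domain) : Matrix (Fin M) (Fin M) 𝕜 :=
  Matrix.of fun i j => inner 𝕜 (v i : E) (H (v j))

/-- `μ 0 ≥ μ 1 ≥ ⋯ ≥ μ (m - 1)` are the proper eigenvalues, listed with multiplicity, of the
generalized eigenvalue problem `H_V x = μ V² x`, where `m = rank V²`: they belong to a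
`V²`-orthonormal system of `m` generalized eigenvectors. The remaining (spurious) values are set
to zero. -/
structure IsProperEigenvalues (H : E →ₗ.[𝕜] E) (v : Fin M → H.domain) (μ : ℕ → ℝ) : Prop where
  antitone : ∀ i j, i ≤ j → j < (gramMatrix v).rank → μ j ≤ μ i
  spurious : ∀ i, (gramMatrix v).rank ≤ i → μ i = 0
  exists_eigenvectors : ∃ x : Fin (gramMatrix v).rank → (Fin M → 𝕜),
    (∀ i j, star (x i) ⬝ᵥ (gramMatrix v).mulVec (x j) = if i = j then 1 else 0) ∧
    ∀ i, (projectedMatrix H v).mulVec (x i) = (μ i : 𝕜) • (gramMatrix v).mulVec (x i)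

/-- The smallest non-zero eigenvalue `λ_{m*}(V²)` of the Gram matrix. -/
noncomputable def minNonzeroEigenvalue {H : E →ₗ.[𝕜] E} (v : Fin M → H.domain) : ℝ :=
  sInf {r : ℝ | r ≠ 0 ∧ Module.End.HasEigenvalue (Matrix.toLin' (gramMatrix v)) (r : 𝕜)}

/-- The spectral measure `|α(E)|² dE`, that is, the measure
`I ↦ Tr ((V I)²) = ∑ l, ‖P(I) v_l‖²`. -/
noncomputable def spectralMeasure {H : E →ₗ.[𝕜] E} (P : ProjectionValuedMeasure 𝕜 E)
    (v : Fin M → H.domain) : Measure ℝ :=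
  ∑ l, P.scalarMeasure (v l : E)

/-- `λ_{m*}^↑(V²)(t)`, evaluated at the right-hand side of a discontinuity: the smallest non-zero
eigenvalue of the Gram matrix of `V (-∞, t]`. (At every `t` that is not an atom of the spectral
measure, `V (-∞, t] = V (-∞, t)`.) -/
noncomputable def lambdaUp {H : E →ₗ.[𝕜] E} {P : ProjectionValuedMeasure 𝕜 E}
    (hP : IsSpectralResolution H P) (v : Fin M → H.domain) (t : ℝ) : ℝ :=
  minNonzeroEigenvalue (projectedGuess hP v (Set.Iic t) measurableSet_Iic)

/-- `λ_{m*}^↓(V²)(t)`, evaluated at the left-hand side of a discontinuity: the smallest non-zero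
eigenvalue of the Gram matrix of `V [t, ∞)`. -/
noncomputable def lambdaDown {H : E →ₗ.[𝕜] E} {P : ProjectionValuedMeasure 𝕜 E}
    (hP : IsSpectralResolution H P) (v : Fin M → H.domain) (t : ℝ) : ℝ :=
  minNonzeroEigenvalue (projectedGuess hP v (Set.Ici t) measurableSet_Ici)

/-- The generalized eigenvalue problem is a signal to the energy interval `(Ea, Eb)`. -/
structure IsSignal {H : E →ₗ.[𝕜] E} {P : ProjectionValuedMeasure 𝕜 E}
    (hP : IsSpectralResolution H P) (v : Fin M → H.domain) (Ea Eb : ℝ) : Prop where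
  upper : ∫⁻ t in Set.Ici Eb, (ENNReal.ofReal (lambdaUp hP v t))⁻¹ ∂spectralMeasure P v ≤ 1
  lower : ∫⁻ t in Set.Iic Ea, (ENNReal.ofReal (lambdaDown hP v t))⁻¹ ∂spectralMeasure P v ≤ 1

end GEP

/-! Write `x = Vz`, `m` for the scalar measure of `x`, `ν` for the spectral measure, `μ = μ_i(B)`,
`b = E_b`. A Courant–Fischer dimension count (`exists_rayleigh_bounds`) gives one `z` whose Rayleigh
quotient is at least `μ_i(V)` for `V`, while the quadratic form of `B` at `z` is at most `μ‖Bz‖²`.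
Hence `(μ_i(V) - μ)‖x‖² ≤ ∫ (t - μ) dm`. The part over `(E_a, E_b)` is nonpositive by the choice of
`z`, the part below `E_a` because `E_a ≤ μ`. It remains to bound the part over `[b, ∞)` by `‖x‖² ∫
(t - μ)/λ↑(t) dν`.

If `ker P(-∞,t]V` is constant for `t ≥ b` (`integral_Ici_le_of_ker_eq`), take `y ⊥ ker V` with `Vy =
x`. Then `m ≤ ‖y‖² ν` and `λ↑(t)‖y‖² ≤ ‖P(-∞,t]Vy‖² ≤ ‖x‖²`, which is the bound.

If the kernel shrinks, a vector newly leaving it carries spectral mass only on the set `G` of jump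
thresholds, so `λ↑(t) ≤ ν(G ∩ (-∞,t])` for `t ∈ G`. Then `G ∩ (-∞,s]` alone contributes at least 1
to the signal integral, for every `s ∈ G`, so `ν` vanishes on the rest of `[b, ∞)`. Thus `ν` on `[b,
∞)` is one atom `τ = inf G` with `λ↑(τ) ≤ ν{τ}` (`exists_atom_of_rankJumpSet_nonempty`), and the
bound is immediate.

The lower estimate is the upper one reflected by `t ↦ -t`. -/

/-! ### Gram matrices and their smallest non-zero eigenvalue. -/

section Gram

variable {𝕜 E : Type*} [RCLike 𝕜] [NormedAddCommGroup E] [InnerProductSpace 𝕜 E] {M : ℕ}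

/-- The synthesis operator `x ↦ ∑ l, x l • w l` of a finite family of vectors. -/
noncomputable def synthesis (w : Fin M → E) : EuclideanSpace 𝕜 (Fin M) →ₗ[𝕜] E :=
  Fintype.linearCombination 𝕜 w ∘ₗ (WithLp.linearEquiv 2 𝕜 (Fin M → 𝕜)).toLinearMap

theorem synthesis_apply (w : Fin M → E) (x : EuclideanSpace 𝕜 (Fin M)) :
    synthesis w x = ∑ l, x l • w l := by
  simp [synthesis, Fintype.linearCombination_apply]

/-- The smallest non-zero eigenvalue of a matrix. -/
noncomputable def smallestNonzeroEigenvalue (A : Matrix (Fin M) (Fin M) 𝕜) : ℝ :=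
  sInf {r : ℝ | r ≠ 0 ∧ Module.End.HasEigenvalue (Matrix.toLin' A) (r : 𝕜)}

theorem hasEigenvalue_ofReal_iff {A : Matrix (Fin M) (Fin M) 𝕜} (hA : A.IsHermitian) (r : ℝ) :
    Module.End.HasEigenvalue (Matrix.toLin' A) (r : 𝕜) ↔ ∃ i, hA.eigenvalues i = r := by
  rw [Module.End.hasEigenvalue_iff_mem_spectrum, Matrix.spectrum_toLin',
    hA.spectrum_eq_image_range]
  simp

theorem inner_synthesis_eigenvectorBasis (w : Fin M → E) (i : Fin M)
    (x : EuclideanSpace 𝕜 (Fin M)) :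
    inner 𝕜 (synthesis w x)
        (synthesis w ((Matrix.isHermitian_gram 𝕜 w).eigenvectorBasis i)) =
      ((Matrix.isHermitian_gram 𝕜 w).eigenvalues i : 𝕜) *
        inner 𝕜 x ((Matrix.isHermitian_gram 𝕜 w).eigenvectorBasis i) := by
  rw [synthesis_apply, synthesis_apply, ← Matrix.star_dotProduct_gram_mulVec,
    Matrix.IsHermitian.mulVec_eigenvectorBasis]
  rw [dotProduct_smul, EuclideanSpace.inner_eq_star_dotProduct, dotProduct_comm,
    RCLike.real_smul_eq_coe_mul]

theorem norm_synthesis_sq (w : Fin M → E) (x : EuclideanSpace 𝕜 (Fin M)) :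
    ‖synthesis w x‖ ^ 2 = ∑ i, (Matrix.isHermitian_gram 𝕜 w).eigenvalues i *
      ‖inner 𝕜 ((Matrix.isHermitian_gram 𝕜 w).eigenvectorBasis i) x‖ ^ 2 := by
  set b := (Matrix.isHermitian_gram 𝕜 w).eigenvectorBasis with hb
  have h : inner 𝕜 (synthesis w x) (synthesis w x) =
      ((∑ i, (Matrix.isHermitian_gram 𝕜 w).eigenvalues i * ‖inner 𝕜 (b i) x‖ ^ 2 : ℝ) : 𝕜) := by
    conv_lhs => enter [3]; rw [← b.sum_repr' x]
    simp only [map_sum, map_smul, inner_sum, inner_smul_right]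
    push_cast
    refine Finset.sum_congr rfl fun i _ => ?_
    rw [inner_synthesis_eigenvectorBasis, mul_left_comm, ← inner_conj_symm x, RCLike.mul_conj]
  rw [inner_self_eq_norm_sq_to_K] at h
  exact_mod_cast h

theorem norm_synthesis_eigenvectorBasis_sq (w : Fin M → E) (i : Fin M) :
    ‖synthesis w ((Matrix.isHermitian_gram 𝕜 w).eigenvectorBasis i)‖ ^ 2 =
      (Matrix.isHermitian_gram 𝕜 w).eigenvalues i := by
  have h := inner_synthesis_eigenvectorBasis w i ((Matrix.isHermitian_gram 𝕜 w).eigenvectorBasis i)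
  rw [inner_self_eq_norm_sq_to_K, inner_self_eq_norm_sq_to_K] at h
  simp only [OrthonormalBasis.norm_eq_one] at h
  norm_num at h
  exact_mod_cast h

theorem smallestNonzeroEigenvalue_gram_le {w : Fin M → E} {i : Fin M}
    (hi : (Matrix.isHermitian_gram 𝕜 w).eigenvalues i ≠ 0) :
    smallestNonzeroEigenvalue (Matrix.gram 𝕜 w) ≤ (Matrix.isHermitian_gram 𝕜 w).eigenvalues i := by
  refine csInf_le ⟨0, ?_⟩ ⟨hi, (hasEigenvalue_ofReal_iff (Matrix.isHermitian_gram 𝕜 w) _).2 ⟨i, rfl⟩⟩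
  rintro r ⟨-, hr⟩
  obtain ⟨j, rfl⟩ := (hasEigenvalue_ofReal_iff (Matrix.isHermitian_gram 𝕜 w) r).1 hr
  exact (Matrix.posSemidef_gram 𝕜 w).eigenvalues_nonneg j

/-- The smallest non-zero eigenvalue of a Gram matrix bounds the quadratic form from below on the
orthogonal complement of the kernel. -/
theorem smallestNonzeroEigenvalue_gram_mul_le (w : Fin M → E) {x : EuclideanSpace 𝕜 (Fin M)}
    (hx : x ∈ (LinearMap.ker (synthesis (𝕜 := 𝕜) w))ᗮ) :
    smallestNonzeroEigenvalue (Matrix.gram 𝕜 w) * ‖x‖ ^ 2 ≤ ‖synthesis w x‖ ^ 2 := by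
  rw [norm_synthesis_sq, ← (Matrix.isHermitian_gram 𝕜 w).eigenvectorBasis.sum_sq_norm_inner_right x,
    Finset.mul_sum]
  refine Finset.sum_le_sum fun i _ => ?_
  -- An eigenvector with eigenvalue zero lies in the kernel, so `x` has no component along it.
  by_cases hi : (Matrix.isHermitian_gram 𝕜 w).eigenvalues i = 0
  · have h0 := norm_synthesis_eigenvectorBasis_sq (𝕜 := 𝕜) w i
    rw [hi, sq_eq_zero_iff, norm_eq_zero] at h0
    rw [(Submodule.mem_orthogonal _ _).1 hx _ (LinearMap.mem_ker.2 h0)]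
    simp
  · gcongr
    exact smallestNonzeroEigenvalue_gram_le hi

/-- The smallest non-zero eigenvalue of a Gram matrix is attained on the orthogonal complement of
the kernel. -/
theorem exists_norm_synthesis_sq_eq {w : Fin M → E} (hw : w ≠ 0) :
    ∃ x ∈ (LinearMap.ker (synthesis (𝕜 := 𝕜) w))ᗮ, ‖x‖ = 1 ∧
      ‖synthesis w x‖ ^ 2 = smallestNonzeroEigenvalue (Matrix.gram 𝕜 w) := by
  set hA := Matrix.isHermitian_gram 𝕜 w
  have hne : ∃ i, hA.eigenvalues i ≠ 0 := by
    by_contra! h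
    refine hw (funext fun l => ?_)
    have h1 := norm_synthesis_sq (𝕜 := 𝕜) w (EuclideanSpace.single l 1)
    simpa [hA, h, synthesis_apply, Pi.single_apply] using h1
  set S := {r : ℝ | r ≠ 0 ∧ Module.End.HasEigenvalue (Matrix.toLin' (Matrix.gram 𝕜 w)) (r : 𝕜)}
  have hfin : S.Finite := by
    refine (Set.finite_range hA.eigenvalues).subset ?_
    rintro r ⟨-, hr⟩
    exact (hasEigenvalue_ofReal_iff hA r).1 hr
  obtain ⟨i₀, hi₀⟩ := hne
  have hmem : sInf S ∈ S :=
    Set.Nonempty.csInf_mem ⟨_, hi₀, (hasEigenvalue_ofReal_iff hA _).2 ⟨i₀, rfl⟩⟩ hfin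
  obtain ⟨i, hi⟩ := (hasEigenvalue_ofReal_iff hA _).1 hmem.2
  refine ⟨hA.eigenvectorBasis i, ?_, by simp, ?_⟩
  · rw [Submodule.mem_orthogonal]
    intro z hz
    have h := inner_synthesis_eigenvectorBasis w i z
    rw [LinearMap.mem_ker.1 hz, inner_zero_left] at h
    have h0 : (hA.eigenvalues i : 𝕜) ≠ 0 := by
      rw [hi]
      exact_mod_cast hmem.1
    exact (mul_eq_zero.1 h.symm).resolve_left h0
  · rw [norm_synthesis_eigenvectorBasis_sq]
    exact hi

theorem smallestNonzeroEigenvalue_gram_pos {w : Fin M → E} (hw : w ≠ 0) :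
    0 < smallestNonzeroEigenvalue (Matrix.gram 𝕜 w) := by
  obtain ⟨x, hx, hx1, h⟩ := exists_norm_synthesis_sq_eq (𝕜 := 𝕜) hw
  rw [← h]
  refine pow_pos (norm_pos_iff.2 fun h0 => ?_) 2
  have := Submodule.inner_right_of_mem_orthogonal (LinearMap.mem_ker.2 h0) hx
  rw [inner_self_eq_zero] at this
  simp [this] at hx1

/-- The minimizer for `w'` is orthogonal to `ker w'`, hence to the smaller `ker w`, and is a
competitor for `w`. Without `hker` this fails: a direction leaving the kernel can create a new,
arbitrarily small non-zero eigenvalue. -/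
theorem smallestNonzeroEigenvalue_gram_mono {w w' : Fin M → E} (hw' : w' ≠ 0)
    (hker : LinearMap.ker (synthesis (𝕜 := 𝕜) w) ≤ LinearMap.ker (synthesis (𝕜 := 𝕜) w'))
    (hle : ∀ x : EuclideanSpace 𝕜 (Fin M), ‖synthesis w x‖ ≤ ‖synthesis w' x‖) :
    smallestNonzeroEigenvalue (Matrix.gram 𝕜 w) ≤ smallestNonzeroEigenvalue (Matrix.gram 𝕜 w') := by
  obtain ⟨x, hx, hx1, h⟩ := exists_norm_synthesis_sq_eq (𝕜 := 𝕜) hw'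
  have := smallestNonzeroEigenvalue_gram_mul_le w (Submodule.orthogonal_le hker hx)
  rw [hx1] at this
  rw [← h]
  calc _ ≤ ‖synthesis w x‖ ^ 2 := by simpa using this
    _ ≤ _ := by gcongr; exact hle x

theorem norm_synthesis_sq_le (w : Fin M → E) (x : EuclideanSpace 𝕜 (Fin M)) :
    ‖synthesis w x‖ ^ 2 ≤ ‖x‖ ^ 2 * ∑ l, ‖w l‖ ^ 2 := by
  rw [synthesis_apply, EuclideanSpace.norm_sq_eq]
  calc ‖∑ l, x l • w l‖ ^ 2 ≤ (∑ l, ‖x l‖ * ‖w l‖) ^ 2 := by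
        gcongr
        exact (norm_sum_le _ _).trans_eq (by simp [norm_smul])
    _ ≤ _ := Finset.sum_mul_sq_le_sq_mul_sq _ _ _

theorem smallestNonzeroEigenvalue_gram_le_sum {w : Fin M → E} (hw : w ≠ 0) :
    smallestNonzeroEigenvalue (Matrix.gram 𝕜 w) ≤ ∑ l, ‖w l‖ ^ 2 := by
  obtain ⟨x, -, hx1, h⟩ := exists_norm_synthesis_sq_eq (𝕜 := 𝕜) hw
  simpa [← h, hx1] using norm_synthesis_sq_le w x

/-- Every vector in the range of the synthesis operator has a preimage orthogonal to the kernel. -/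
theorem exists_mem_orthogonal_ker_synthesis_eq (v : Fin M → E)
    (x : EuclideanSpace 𝕜 (Fin M)) :
    ∃ y ∈ (LinearMap.ker (synthesis (𝕜 := 𝕜) v))ᗮ,
      x - y ∈ LinearMap.ker (synthesis (𝕜 := 𝕜) v) ∧ synthesis v y = synthesis v x := by
  set K := LinearMap.ker (synthesis (𝕜 := 𝕜) v)
  refine ⟨x - K.starProjection x, K.sub_starProjection_mem_orthogonal x, ?_, ?_⟩
  · rw [sub_sub_cancel]
    exact K.starProjection_apply_mem x
  · rw [map_sub, LinearMap.mem_ker.1 (K.starProjection_apply_mem x), sub_zero]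

end Gram

/-! ### The generalized eigenvalue problem and its min-max dimension count. -/

section ProperEigenvalues

variable {𝕜 E : Type*} [RCLike 𝕜] [NormedAddCommGroup E] [InnerProductSpace 𝕜 E] {M : ℕ}

theorem coe_linearCombination_eq_synthesis {H : E →ₗ.[𝕜] E} (v : Fin M → H.domain)
    (z : Fin M → 𝕜) :
    (Fintype.linearCombination 𝕜 v z : E) = synthesis (fun l => (v l : E)) (WithLp.toLp 2 z) := by
  simp [synthesis_apply, Fintype.linearCombination_apply]

theorem star_dotProduct_gramMatrix_mulVec {H : E →ₗ.[𝕜] E} (w : Fin M → H.domain)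
    (x z : Fin M → 𝕜) :
    star x ⬝ᵥ (gramMatrix w).mulVec z =
      inner 𝕜 (Fintype.linearCombination 𝕜 w x : E) (Fintype.linearCombination 𝕜 w z : E) := by
  rw [gramMatrix, Matrix.star_dotProduct_gram_mulVec]
  simp [Fintype.linearCombination_apply]

theorem star_dotProduct_projectedMatrix_mulVec (H : E →ₗ.[𝕜] E) (w : Fin M → H.domain)
    (x z : Fin M → 𝕜) :
    star x ⬝ᵥ (projectedMatrix H w).mulVec z =
      inner 𝕜 (Fintype.linearCombination 𝕜 w x : E) (H (Fintype.linearCombination 𝕜 w z)) := by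
  have h : H (Fintype.linearCombination 𝕜 w z) = ∑ l, z l • H (w l) := by
    rw [← LinearPMap.toFun_eq_coe, Fintype.linearCombination_apply, map_sum]
    simp
  rw [h]
  simp only [Fintype.linearCombination_apply, Submodule.coe_sum, Submodule.coe_smul, sum_inner,
    inner_sum, inner_smul_left, inner_smul_right, dotProduct, Matrix.mulVec, projectedMatrix,
    Matrix.of_apply, Finset.mul_sum, Pi.star_apply, RCLike.star_def]
  rw [Finset.sum_comm]
  refine Finset.sum_congr rfl fun i _ => Finset.sum_congr rfl fun j _ => by ring

open scoped ComplexOrder in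
theorem ker_gramMatrix {H : E →ₗ.[𝕜] E} (w : Fin M → H.domain) :
    LinearMap.ker (gramMatrix w).mulVecLin =
      LinearMap.ker (Fintype.linearCombination 𝕜 w) := by
  ext z
  simp only [LinearMap.mem_ker, Matrix.mulVecLin_apply]
  constructor
  · intro h
    have := star_dotProduct_gramMatrix_mulVec w z z
    rw [h, dotProduct_zero, eq_comm, inner_self_eq_zero] at this
    exact_mod_cast this
  · intro h
    have := star_dotProduct_gramMatrix_mulVec w ((gramMatrix w).mulVec z) z
    rw [h] at this
    rwa [ZeroMemClass.coe_zero, inner_zero_right, dotProduct_star_self_eq_zero] at this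

theorem rank_gramMatrix {H : E →ₗ.[𝕜] E} (w : Fin M → H.domain) :
    (gramMatrix w).rank = Module.finrank 𝕜 (LinearMap.range (Fintype.linearCombination 𝕜 w)) := by
  have h1 := (gramMatrix w).mulVecLin.finrank_range_add_finrank_ker
  have h2 := (Fintype.linearCombination 𝕜 w).finrank_range_add_finrank_ker
  rw [ker_gramMatrix] at h1
  rw [Matrix.rank]
  omega

/-- The generalized eigenvectors diagonalize both quadratic forms simultaneously. -/
theorem IsProperEigenvalues.exists_diagonalization {H : E →ₗ.[𝕜] E} {w : Fin M → H.domain}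
    {μ : ℕ → ℝ} (h : IsProperEigenvalues H w μ) :
    ∃ (x : Fin (gramMatrix w).rank → Fin M → 𝕜)
      (c : (Fin M → 𝕜) →ₗ[𝕜] (Fin (gramMatrix w).rank → 𝕜)),
      (∀ j, c (x j) = Pi.single j 1) ∧
      (∀ z, ‖(Fintype.linearCombination 𝕜 w z : E)‖ ^ 2 = ∑ j, ‖c z j‖ ^ 2) ∧
      ∀ z, RCLike.re (inner 𝕜 (Fintype.linearCombination 𝕜 w z : E)
        (H (Fintype.linearCombination 𝕜 w z))) = ∑ j : Fin (gramMatrix w).rank, μ j * ‖c z j‖ ^ 2 := by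
  obtain ⟨x, horth, heig⟩ := h.exists_eigenvectors
  set L := Fintype.linearCombination 𝕜 w with hL
  let y : Fin (gramMatrix w).rank → LinearMap.range L := fun j => ⟨L (x j), x j, rfl⟩
  have hy : Orthonormal 𝕜 y := by
    rw [orthonormal_iff_ite]
    intro i j
    rw [← horth i j, star_dotProduct_gramMatrix_mulVec]
    rfl
  -- The rank of the Gram matrix is the dimension of the range of `L`, so the orthonormal images `y
  -- j` form a basis of it.
  have hspan : Submodule.span 𝕜 (Set.range y) = ⊤ :=
    hy.linearIndependent.span_eq_top_of_card_eq_finrank' (by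
      rw [Fintype.card_fin]; exact rank_gramMatrix w)
  let b : OrthonormalBasis (Fin (gramMatrix w).rank) 𝕜 (LinearMap.range L) :=
    OrthonormalBasis.mk hy hspan.ge
  have hb : ∀ j, b j = y j := fun j => by simp [b]
  let c : (Fin M → 𝕜) →ₗ[𝕜] (Fin (gramMatrix w).rank → 𝕜) :=
    LinearMap.pi fun j => (innerₛₗ 𝕜 (y j)) ∘ₗ L.rangeRestrict
  have hc : ∀ z j, c z j = inner 𝕜 (y j) (L.rangeRestrict z) := fun z j => rfl
  refine ⟨x, c, fun j => ?_, fun z => ?_, fun z => ?_⟩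
  · ext k
    rw [hc, show L.rangeRestrict (x j) = y j from rfl, orthonormal_iff_ite.1 hy,
      Pi.single_apply]
  · have := b.sum_sq_norm_inner_right (L.rangeRestrict z)
    simp only [hb, ← hc] at this
    rw [this]
    rfl
  · have hz : L z = L (∑ j, c z j • x j) := by
      have := b.sum_repr' (L.rangeRestrict z)
      simp only [hb, ← hc] at this
      have h2 := congrArg (Subtype.val) this
      rw [map_sum]
      simp only [map_smul]
      simpa [y] using h2.symm
    have key : inner 𝕜 (L z : E) (H (L z)) =
        ((∑ j : Fin (gramMatrix w).rank, μ j * ‖c z j‖ ^ 2 : ℝ) : 𝕜) := by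
      -- Only the argument of `H` is expanded, so that each `x j` meets the eigenvalue equation and
      -- turns `H` into the Gram form.
      conv_lhs => enter [3]; rw [hz]
      rw [← star_dotProduct_projectedMatrix_mulVec, Matrix.mulVec_sum, dotProduct_sum]
      push_cast
      refine Finset.sum_congr rfl fun j _ => ?_
      rw [Matrix.mulVec_smul, heig, dotProduct_smul, dotProduct_smul,
        star_dotProduct_gramMatrix_mulVec, smul_eq_mul, smul_eq_mul, mul_left_comm]
      congr 1
      have : inner 𝕜 (L z : E) (L (x j) : E) = (starRingEnd 𝕜) (c z j) := by
        rw [hc]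
        exact (inner_conj_symm _ _).symm
      rw [← hL, this, RCLike.mul_conj]
    rw [key, RCLike.ofReal_re]

/-- A dimension count in the spirit of Courant and Fischer: some coefficient vector has Rayleigh
quotient at least `μ i` for one family and at most `μ' i` for the other. -/
theorem exists_rayleigh_bounds {H : E →ₗ.[𝕜] E} {w w' : Fin M → H.domain} {μ μ' : ℕ → ℝ}
    (h : IsProperEigenvalues H w μ) (h' : IsProperEigenvalues H w' μ') {i : ℕ}
    (hi : i < (gramMatrix w).rank) (hi' : i < (gramMatrix w').rank) :
    ∃ z : Fin M → 𝕜, Fintype.linearCombination 𝕜 w z ≠ 0 ∧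
      μ i * ‖(Fintype.linearCombination 𝕜 w z : E)‖ ^ 2 ≤
        RCLike.re (inner 𝕜 (Fintype.linearCombination 𝕜 w z : E)
          (H (Fintype.linearCombination 𝕜 w z))) ∧
      RCLike.re (inner 𝕜 (Fintype.linearCombination 𝕜 w' z : E)
          (H (Fintype.linearCombination 𝕜 w' z))) ≤
        μ' i * ‖(Fintype.linearCombination 𝕜 w' z : E)‖ ^ 2 := by
  obtain ⟨x, c, hx, hn, hq⟩ := h.exists_diagonalization
  obtain ⟨x', c', hx', hn', hq'⟩ := h'.exists_diagonalization
  -- Indices start at 0: the `i + 1` top eigenvectors of `w` span the trial space, and only `i`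
  -- conditions are imposed, namely vanishing of the top `i` coordinates for `w'`. A nonzero
  -- solution `a` exists.
  let T : (Fin (i + 1) → 𝕜) →ₗ[𝕜] (Fin M → 𝕜) :=
    Fintype.linearCombination 𝕜 fun k : Fin (i + 1) => x (Fin.castLE hi k)
  let F : (Fin (i + 1) → 𝕜) →ₗ[𝕜] (Fin i → 𝕜) :=
    LinearMap.pi fun k => LinearMap.proj (Fin.castLE hi'.le k) ∘ₗ c' ∘ₗ T
  have hF : LinearMap.ker F ≠ ⊥ := LinearMap.ker_ne_bot_of_finrank_lt (by simp)
  obtain ⟨a, ha, ha0⟩ := (Submodule.ne_bot_iff _).1 hF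
  have hcT : c (T a) = ∑ k, Pi.single (Fin.castLE hi k) (a k) := by
    simp only [T, Fintype.linearCombination_apply, map_sum, map_smul, hx]
    refine Finset.sum_congr rfl fun k _ => ?_
    rw [← Pi.single_smul, smul_eq_mul, mul_one]
  have hval : ∀ k, c (T a) (Fin.castLE hi k) = a k := by
    intro k
    rw [hcT, Finset.sum_apply, Finset.sum_eq_single k]
    · simp
    · intro b _ hb
      rw [Pi.single_eq_of_ne]
      exact fun e => hb (Fin.castLE_injective hi e).symm
    · simp
  have hzero : ∀ j : Fin (gramMatrix w).rank, i < j → c (T a) j = 0 := by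
    intro j hj
    rw [hcT, Finset.sum_apply]
    refine Finset.sum_eq_zero fun k _ => Pi.single_eq_of_ne (M := fun _ => 𝕜) ?_ _
    intro e
    have := congrArg Fin.val e
    simp at this
    omega
  refine ⟨T a, fun h0 => ha0 ?_, ?_, ?_⟩
  · have hsum : ∑ j, ‖c (T a) j‖ ^ 2 = 0 := by
      rw [← hn, h0]
      simp
    ext k
    rw [← hval]
    have h1 := (Finset.sum_eq_zero_iff_of_nonneg fun j _ => sq_nonneg ‖c (T a) j‖).1 hsum
      (Fin.castLE hi k) (Finset.mem_univ _)
    simpa using h1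
  · rw [hn, hq, Finset.mul_sum]
    refine Finset.sum_le_sum fun j _ => ?_
    rcases le_or_gt (j : ℕ) i with hj | hj
    · gcongr
      exact h.antitone j i hj hi
    · simp [hzero j hj]
  · rw [hn', hq', Finset.mul_sum]
    refine Finset.sum_le_sum fun j _ => ?_
    rcases le_or_gt i (j : ℕ) with hj | hj
    · gcongr
      exact h'.antitone i j hj j.2
    · have h1 : c' (T a) j = 0 := congrFun (LinearMap.mem_ker.1 ha) ⟨j, hj⟩
      simp [h1]

end ProperEigenvalues

/-! ### Spectral measures of the guess vectors, and the moment bound when the kernel is constant. -/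

namespace ProjectionValuedMeasure

variable {𝕜 E : Type*} [RCLike 𝕜] [NormedAddCommGroup E] [InnerProductSpace 𝕜 E]
  [CompleteSpace E] {M : ℕ} (P : ProjectionValuedMeasure 𝕜 E)

instance isFiniteMeasure_scalarMeasure (x : E) : IsFiniteMeasure (P.scalarMeasure x) :=
  ⟨by rw [P.scalarMeasure_apply MeasurableSet.univ]; exact ENNReal.ofReal_lt_top⟩

theorem scalarMeasure_real {s : Set ℝ} (hs : MeasurableSet s) (x : E) :
    (P.scalarMeasure x).real s = ‖P.proj s x‖ ^ 2 := by
  rw [measureReal_def, P.scalarMeasure_apply hs, ENNReal.toReal_ofReal (by positivity)]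

theorem scalarMeasure_real_univ (x : E) : (P.scalarMeasure x).real Set.univ = ‖x‖ ^ 2 := by
  rw [P.scalarMeasure_real MeasurableSet.univ, P.proj_univ]
  simp

theorem scalarMeasure_eq_zero_iff {s : Set ℝ} (hs : MeasurableSet s) (x : E) :
    P.scalarMeasure x s = 0 ↔ P.proj s x = 0 := by
  rw [← measureReal_eq_zero_iff, P.scalarMeasure_real hs]
  simp

theorem norm_proj_le_of_subset {s t : Set ℝ} (hs : MeasurableSet s) (ht : MeasurableSet t)
    (hst : s ⊆ t) (x : E) : ‖P.proj s x‖ ≤ ‖P.proj t x‖ := by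
  have h := measureReal_mono hst (μ := P.scalarMeasure x)
  rw [P.scalarMeasure_real hs, P.scalarMeasure_real ht] at h
  exact (pow_le_pow_iff_left₀ (norm_nonneg _) (norm_nonneg _) two_ne_zero).1 h

/-- The measure `s ↦ ∑ l, ‖P(s) v_l‖²` of a finite family of vectors. -/
noncomputable def traceMeasure (v : Fin M → E) : Measure ℝ :=
  ∑ l, P.scalarMeasure (v l)

/-- The smallest non-zero eigenvalue of the Gram matrix of the projected family `P(s) v`. -/
noncomputable def gramGap (v : Fin M → E) (s : Set ℝ) : ℝ :=
  smallestNonzeroEigenvalue (Matrix.gram 𝕜 fun l => P.proj s (v l))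

instance isFiniteMeasure_traceMeasure (v : Fin M → E) : IsFiniteMeasure (P.traceMeasure v) := by
  unfold traceMeasure
  infer_instance

theorem traceMeasure_apply {s : Set ℝ} (hs : MeasurableSet s) (v : Fin M → E) :
    P.traceMeasure v s = ENNReal.ofReal (∑ l, ‖P.proj s (v l)‖ ^ 2) := by
  rw [traceMeasure, Measure.finsetSum_apply, ENNReal.ofReal_sum_of_nonneg
    fun _ _ => by positivity]
  simp [P.scalarMeasure_apply hs]

theorem traceMeasure_real {s : Set ℝ} (hs : MeasurableSet s) (v : Fin M → E) :
    (P.traceMeasure v).real s = ∑ l, ‖P.proj s (v l)‖ ^ 2 := by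
  rw [measureReal_def, P.traceMeasure_apply hs,
    ENNReal.toReal_ofReal (Finset.sum_nonneg fun _ _ => by positivity)]

theorem synthesis_proj (v : Fin M → E) (s : Set ℝ) (x : EuclideanSpace 𝕜 (Fin M)) :
    synthesis (fun l => P.proj s (v l)) x = P.proj s (synthesis v x) := by
  simp [synthesis_apply]

theorem scalarMeasure_synthesis_real_le {s : Set ℝ} (hs : MeasurableSet s) (v : Fin M → E)
    (x : EuclideanSpace 𝕜 (Fin M)) :
    (P.scalarMeasure (synthesis v x)).real s ≤ ‖x‖ ^ 2 * (P.traceMeasure v).real s := by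
  rw [P.scalarMeasure_real hs, P.traceMeasure_real hs, ← P.synthesis_proj]
  exact norm_synthesis_sq_le _ x

theorem scalarMeasure_synthesis_le (v : Fin M → E) (x : EuclideanSpace 𝕜 (Fin M)) :
    P.scalarMeasure (synthesis v x) ≤ ENNReal.ofReal (‖x‖ ^ 2) • P.traceMeasure v := by
  refine Measure.le_iff.2 fun s hs => ?_
  rw [Measure.smul_apply, smul_eq_mul, P.scalarMeasure_apply hs, P.traceMeasure_apply hs,
    ← ENNReal.ofReal_mul (by positivity), ← P.synthesis_proj]
  exact ENNReal.ofReal_le_ofReal (norm_synthesis_sq_le _ x)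

theorem gramGap_mul_le (v : Fin M → E) {s : Set ℝ} (hs : MeasurableSet s)
    {x : EuclideanSpace 𝕜 (Fin M)}
    (hx : x ∈ (LinearMap.ker (synthesis (𝕜 := 𝕜) fun l => P.proj s (v l)))ᗮ) :
    P.gramGap v s * ‖x‖ ^ 2 ≤ (P.scalarMeasure (synthesis v x)).real s := by
  rw [P.scalarMeasure_real hs, ← P.synthesis_proj]
  exact smallestNonzeroEigenvalue_gram_mul_le _ hx

variable {P}

theorem proj_ne_zero_of_subset {v : Fin M → E} {s t : Set ℝ} (hs : MeasurableSet s)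
    (ht : MeasurableSet t) (hst : s ⊆ t) (h : (fun l => P.proj s (v l)) ≠ 0) :
    (fun l => P.proj t (v l)) ≠ 0 := by
  contrapose! h
  ext l
  have := P.norm_proj_le_of_subset hs ht hst (v l)
  rw [show P.proj t (v l) = 0 from congrFun h l, norm_zero] at this
  exact norm_le_zero_iff.1 this

variable (P)

theorem ker_synthesis_proj_le (v : Fin M → E) {s t : Set ℝ} (hs : MeasurableSet s)
    (ht : MeasurableSet t) (hst : s ⊆ t) :
    LinearMap.ker (synthesis (𝕜 := 𝕜) fun l => P.proj t (v l)) ≤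
      LinearMap.ker (synthesis (𝕜 := 𝕜) fun l => P.proj s (v l)) := by
  intro x hx
  rw [LinearMap.mem_ker, synthesis_proj] at hx ⊢
  have := P.norm_proj_le_of_subset hs ht hst (synthesis v x)
  rw [hx, norm_zero] at this
  exact norm_le_zero_iff.1 this

theorem gramGap_le_traceMeasure_univ {v : Fin M → E} {s : Set ℝ} (hs : MeasurableSet s)
    (h : (fun l => P.proj s (v l)) ≠ 0) :
    P.gramGap v s ≤ (P.traceMeasure v).real Set.univ :=
  (smallestNonzeroEigenvalue_gram_le_sum h).trans (by
    rw [← P.traceMeasure_real hs]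
    exact measureReal_mono (Set.subset_univ _))

/-- If the kernel of `P((-∞, t]) v` does not depend on `t ≥ b`, the spectral mass above `b` of a
vector in the span of `v` is controlled by the trace measure. -/
theorem integral_Ici_le_of_ker_eq (v : Fin M → E)
    (hid : Integrable (fun t : ℝ => t) (P.traceMeasure v)) {b μ : ℝ} (hμ : μ ≤ b)
    (hb : (fun l => P.proj (Set.Iic b) (v l)) ≠ 0)
    (hker : ∀ t, b ≤ t → ∀ x : EuclideanSpace 𝕜 (Fin M),
      P.proj (Set.Iic b) (synthesis v x) = 0 → P.proj (Set.Iic t) (synthesis v x) = 0) :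
    IntegrableOn (fun t => (t - μ) / P.gramGap v (Set.Iic t)) (Set.Ici b) (P.traceMeasure v) ∧
    ∀ x : EuclideanSpace 𝕜 (Fin M),
      ∫ t in Set.Ici b, (t - μ) ∂P.scalarMeasure (synthesis v x) ≤
        ‖synthesis v x‖ ^ 2 *
          ∫ t in Set.Ici b, (t - μ) / P.gramGap v (Set.Iic t) ∂P.traceMeasure v := by
  have hne : ∀ t, b ≤ t → (fun l => P.proj (Set.Iic t) (v l)) ≠ 0 := fun t ht =>
    proj_ne_zero_of_subset measurableSet_Iic measurableSet_Iic (Set.Iic_subset_Iic.2 ht) hb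
  have hpos : ∀ t, b ≤ t → 0 < P.gramGap v (Set.Iic t) := fun t ht =>
    smallestNonzeroEigenvalue_gram_pos (hne t ht)
  have hkereq : ∀ t, b ≤ t →
      LinearMap.ker (synthesis (𝕜 := 𝕜) fun l => P.proj (Set.Iic b) (v l)) ≤
      LinearMap.ker (synthesis (𝕜 := 𝕜) fun l => P.proj (Set.Iic t) (v l)) := by
    intro t ht x hx
    rw [LinearMap.mem_ker, synthesis_proj] at hx ⊢
    exact hker t ht x hx
  have hmono : MonotoneOn (fun t => P.gramGap v (Set.Iic t)) (Set.Ici b) := by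
    intro s hs t ht hst
    refine smallestNonzeroEigenvalue_gram_mono (hne t ht) ?_ fun x => ?_
    · exact (P.ker_synthesis_proj_le v measurableSet_Iic measurableSet_Iic
        (Set.Iic_subset_Iic.2 hs)).trans (hkereq t ht)
    · rw [synthesis_proj, synthesis_proj]
      exact P.norm_proj_le_of_subset measurableSet_Iic measurableSet_Iic
        (Set.Iic_subset_Iic.2 hst) _
  have hid' : Integrable (fun t : ℝ => t - μ) (P.traceMeasure v) :=
    hid.sub (integrable_const μ)
  have hI : IntegrableOn (fun t => (t - μ) / P.gramGap v (Set.Iic t)) (Set.Ici b)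
      (P.traceMeasure v) := by
    -- Above `b` the gap is monotone, hence measurable and at least its positive value at `b`.
    refine Integrable.mono' ((hid'.norm.div_const (P.gramGap v (Set.Iic b))).integrableOn) ?_ ?_
    · exact (measurable_id.sub_const μ).aemeasurable.div
        (aemeasurable_restrict_of_monotoneOn measurableSet_Ici hmono) |>.aestronglyMeasurable
    · refine (ae_restrict_iff' measurableSet_Ici).2 (ae_of_all _ fun t ht => ?_)
      rw [norm_div, Real.norm_of_nonneg (hpos t ht).le]
      have := hpos b le_rfl
      gcongr
      exact hmono Set.self_mem_Ici ht ht
  refine ⟨hI, fun x => ?_⟩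
  obtain ⟨y, hy, -, hyx⟩ := exists_mem_orthogonal_ker_synthesis_eq v x
  rw [← hyx]
  have hy' : ∀ t, b ≤ t →
      y ∈ (LinearMap.ker (synthesis (𝕜 := 𝕜) fun l => P.proj (Set.Iic t) (v l)))ᗮ := by
    intro t ht
    -- `y` is orthogonal to `ker V`, so it suffices that `ker P(-∞,t]V ⊆ ker V`. If `P(-∞,t]Vz = 0`,
    -- then `Vz` has no mass below `b`, hence by `hker` none below any threshold, and `Vz = 0`.
    refine Submodule.orthogonal_le (fun z hz => ?_) hy
    have hz' := P.ker_synthesis_proj_le v measurableSet_Iic measurableSet_Iic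
      (Set.Iic_subset_Iic.2 ht) hz
    rw [LinearMap.mem_ker, synthesis_proj] at hz'
    have hU : P.scalarMeasure (synthesis v z) Set.univ = 0 := by
      refine measure_null_of_locally_null _ fun r _ => ⟨Set.Iic (max b (r + 1)), ?_, ?_⟩
      · exact mem_nhdsWithin_of_mem_nhds (Iic_mem_nhds (lt_max_of_lt_right (lt_add_one r)))
      · rw [P.scalarMeasure_eq_zero_iff measurableSet_Iic]
        exact hker _ (le_max_left _ _) z hz'
    rw [P.scalarMeasure_eq_zero_iff MeasurableSet.univ, P.proj_univ] at hU
    exact hU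
  have hle : (P.scalarMeasure (synthesis v y)).restrict (Set.Ici b) ≤
      (ENNReal.ofReal (‖y‖ ^ 2) • P.traceMeasure v).restrict (Set.Ici b) :=
    Measure.restrict_mono le_rfl (P.scalarMeasure_synthesis_le v y)
  calc ∫ t in Set.Ici b, (t - μ) ∂P.scalarMeasure (synthesis v y)
      ≤ ∫ t in Set.Ici b, (t - μ) ∂(ENNReal.ofReal (‖y‖ ^ 2) • P.traceMeasure v) := by
        refine integral_mono_measure hle ?_ ?_
        · refine (ae_restrict_iff' measurableSet_Ici).2 (ae_of_all _ fun t ht => ?_)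
          exact sub_nonneg.2 (hμ.trans ht)
        · exact (hid'.smul_measure ENNReal.ofReal_ne_top).integrableOn
    _ = ∫ t in Set.Ici b, ‖y‖ ^ 2 * (t - μ) ∂P.traceMeasure v := by
        rw [Measure.restrict_smul, integral_smul_measure, ENNReal.toReal_ofReal (by positivity),
          smul_eq_mul, integral_const_mul]
    _ ≤ ∫ t in Set.Ici b, ‖synthesis v y‖ ^ 2 * ((t - μ) / P.gramGap v (Set.Iic t))
          ∂P.traceMeasure v := by
        refine setIntegral_mono_on (hid'.const_mul _).integrableOn (hI.const_mul _)
          measurableSet_Ici fun t ht => ?_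
        have h1 := P.gramGap_mul_le v measurableSet_Iic (hy' t ht)
        have h2 : (P.scalarMeasure (synthesis v y)).real (Set.Iic t) ≤ ‖synthesis v y‖ ^ 2 := by
          rw [← P.scalarMeasure_real_univ]
          exact measureReal_mono (Set.subset_univ _)
        rw [← mul_div_assoc, le_div_iff₀ (hpos t ht)]
        have h3 : 0 ≤ t - μ := sub_nonneg.2 (hμ.trans ht)
        nlinarith [mul_le_mul_of_nonneg_right (h1.trans h2) h3]
    _ = _ := integral_const_mul _ _

end ProjectionValuedMeasure

/-! ### Rank jumps above the threshold. -/

namespace ProjectionValuedMeasure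

variable {𝕜 E : Type*} [RCLike 𝕜] [NormedAddCommGroup E] [InnerProductSpace 𝕜 E]
  [CompleteSpace E] {M : ℕ} (P : ProjectionValuedMeasure 𝕜 E)

/-- The thresholds `t ≥ b` at which the kernel of `P((-∞, t]) v` is smaller than that of
`P((-∞, b]) v`. -/
def rankJumpSet (v : Fin M → E) (b : ℝ) : Set ℝ :=
  {t | b ≤ t ∧ ∃ x : EuclideanSpace 𝕜 (Fin M),
    P.proj (Set.Iic b) (synthesis v x) = 0 ∧ P.proj (Set.Iic t) (synthesis v x) ≠ 0}

variable {P}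

theorem mem_rankJumpSet_of_le {v : Fin M → E} {b s t : ℝ} (hs : s ∈ P.rankJumpSet v b)
    (hst : s ≤ t) : t ∈ P.rankJumpSet v b := by
  obtain ⟨hbs, x, hx, hx'⟩ := hs
  refine ⟨hbs.trans hst, x, hx, fun h => hx' ?_⟩
  have := P.norm_proj_le_of_subset measurableSet_Iic measurableSet_Iic
    (Set.Iic_subset_Iic.2 hst) (synthesis v x)
  rw [h, norm_zero] at this
  exact norm_le_zero_iff.1 this

theorem measurableSet_rankJumpSet (v : Fin M → E) (b : ℝ) : MeasurableSet (P.rankJumpSet v b) :=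
  Set.OrdConnected.measurableSet ⟨fun _ hs _ _ _ ht => mem_rankJumpSet_of_le hs ht.1⟩

/-- The complement is a down-set, and each `(-∞, r]` with `r` in it is null. If it has a maximum,
one such ray covers it; otherwise these rays are neighbourhoods of its points. -/
theorem scalarMeasure_compl_rankJumpSet {v : Fin M → E} {b : ℝ} {x : EuclideanSpace 𝕜 (Fin M)}
    (hx : P.proj (Set.Iic b) (synthesis v x) = 0) :
    P.scalarMeasure (synthesis v x) (P.rankJumpSet v b)ᶜ = 0 := by
  have hnull : ∀ r ∈ (P.rankJumpSet v b)ᶜ, P.scalarMeasure (synthesis v x) (Set.Iic r) = 0 := by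
    intro r hr
    rcases le_or_gt b r with h | h
    · rw [P.scalarMeasure_eq_zero_iff measurableSet_Iic]
      by_contra h0
      exact hr ⟨h, x, hx, h0⟩
    · exact measure_mono_null (Set.Iic_subset_Iic.2 h.le)
        ((P.scalarMeasure_eq_zero_iff measurableSet_Iic _).2 hx)
  refine measure_null_of_locally_null _ fun r hr => ?_
  by_cases hmax : ∃ s ∈ (P.rankJumpSet v b)ᶜ, r < s
  · obtain ⟨s, hs, hrs⟩ := hmax
    exact ⟨Set.Iic s, mem_nhdsWithin_of_mem_nhds (Iic_mem_nhds hrs), hnull s hs⟩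
  · push Not at hmax
    exact ⟨Set.Iic r, Filter.mem_of_superset self_mem_nhdsWithin hmax, hnull r hr⟩

/-- A vector newly seen at `t`, corrected to be orthogonal to the kernel at `t`, is still invisible
at `b`. Up to `t` it therefore has mass only in the jump set, and its mass there is at most `‖y‖²`
times the trace measure. -/
theorem gramGap_le_of_mem_rankJumpSet {v : Fin M → E} {b t : ℝ} (ht : t ∈ P.rankJumpSet v b) :
    P.gramGap v (Set.Iic t) ≤ (P.traceMeasure v).real (P.rankJumpSet v b ∩ Set.Iic t) := by
  obtain ⟨x, hx, hx'⟩ := ht.2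
  obtain ⟨y, hy, hxy, hyx⟩ := exists_mem_orthogonal_ker_synthesis_eq (𝕜 := 𝕜)
    (fun l => P.proj (Set.Iic t) (v l)) x
  have hyb : P.proj (Set.Iic b) (synthesis v y) = 0 := by
    have h := P.ker_synthesis_proj_le v measurableSet_Iic measurableSet_Iic
      (Set.Iic_subset_Iic.2 ht.1) hxy
    rw [LinearMap.mem_ker, synthesis_proj, map_sub, map_sub, hx, zero_sub, neg_eq_zero] at h
    exact h
  have hy0 : y ≠ 0 := by
    rintro rfl
    rw [map_zero, synthesis_proj] at hyx
    exact hx' hyx.symm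
  have h1 := P.gramGap_mul_le v measurableSet_Iic hy
  have h2 : (P.scalarMeasure (synthesis v y)).real (Set.Iic t) ≤
      (P.scalarMeasure (synthesis v y)).real (P.rankJumpSet v b ∩ Set.Iic t) := by
    rw [measureReal_def, measureReal_def]
    refine ENNReal.toReal_mono (measure_ne_top _ _) ?_
    rw [Set.inter_comm, measure_inter_conull' ?_]
    exact measure_mono_null (fun r hr => hr.2) (scalarMeasure_compl_rankJumpSet hyb)
  have h3 := P.scalarMeasure_synthesis_real_le
    ((measurableSet_rankJumpSet v b).inter measurableSet_Iic) v y (s := P.rankJumpSet v b ∩ Set.Iic t)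
  have h4 : 0 < ‖y‖ ^ 2 := by positivity
  refine le_of_mul_le_mul_right ?_ h4
  linarith

/-- Under the signal condition a jump of the rank above `b` forces the trace measure above `b` to
be a single atom, of mass at least the corresponding smallest non-zero eigenvalue. -/
theorem exists_atom_of_rankJumpSet_nonempty {v : Fin M → E} {b : ℝ}
    (hb : (fun l => P.proj (Set.Iic b) (v l)) ≠ 0)
    (hsignal : ∫⁻ t in Set.Ici b, (ENNReal.ofReal (P.gramGap v (Set.Iic t)))⁻¹
      ∂P.traceMeasure v ≤ 1) (hG : (P.rankJumpSet v b).Nonempty) :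
    ∃ τ, b ≤ τ ∧ P.traceMeasure v (Set.Ici b \ {τ}) = 0 ∧
      0 < P.gramGap v (Set.Iic τ) ∧
      P.gramGap v (Set.Iic τ) ≤ (P.traceMeasure v).real {τ} := by
  set ν := P.traceMeasure v with hν
  set G := P.rankJumpSet v b with hGdef
  set gap : ℝ → ℝ := fun t => P.gramGap v (Set.Iic t) with hgap
  have hGm : MeasurableSet G := measurableSet_rankJumpSet v b
  have hne : ∀ t, b ≤ t → (fun l => P.proj (Set.Iic t) (v l)) ≠ 0 := fun t ht =>
    proj_ne_zero_of_subset measurableSet_Iic measurableSet_Iic (Set.Iic_subset_Iic.2 ht) hb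
  have hpos : ∀ t, b ≤ t → 0 < gap t := fun t ht => smallestNonzeroEigenvalue_gram_pos (hne t ht)
  have hGpos : ∀ s ∈ G, 0 < ν.real (G ∩ Set.Iic s) := fun s hs =>
    (hpos s hs.1).trans_le (gramGap_le_of_mem_rankJumpSet hs)
  -- On `G ∩ (-∞,s]` the weight `1 / gap` is at least the constant `1 / ν(G ∩ (-∞,s])`.
  have hone : ∀ s ∈ G, 1 ≤ ∫⁻ t in G ∩ Set.Iic s, (ENNReal.ofReal (gap t))⁻¹ ∂ν := by
    intro s hs
    have hs0 : ν (G ∩ Set.Iic s) ≠ 0 := fun h => by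
      have := hGpos s hs
      rw [measureReal_def, h] at this
      simp at this
    calc (1 : ENNReal) = ∫⁻ _ in G ∩ Set.Iic s, (ν (G ∩ Set.Iic s))⁻¹ ∂ν := by
          rw [setLIntegral_const, ENNReal.inv_mul_cancel hs0 (measure_ne_top _ _)]
      _ ≤ _ := by
          refine setLIntegral_mono' (hGm.inter measurableSet_Iic) fun t ht => ?_
          rw [ENNReal.inv_le_inv]
          refine ENNReal.ofReal_le_of_le_toReal ?_
          exact (gramGap_le_of_mem_rankJumpSet ht.1).trans
            (measureReal_mono (Set.inter_subset_inter_right _ (Set.Iic_subset_Iic.2 ht.2)))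
  -- The whole signal budget 1 is spent on `G ∩ (-∞,s]`. Elsewhere on `[b, ∞)` the weighted integral
  -- is zero although the weight is at least `1 / ν(ℝ) > 0`.
  have hnull : ∀ s ∈ G, ν (Set.Ici b \ (G ∩ Set.Iic s)) = 0 := by
    intro s hs
    have hsub : G ∩ Set.Iic s ⊆ Set.Ici b := fun t ht => ht.1.1
    have hsplit := lintegral_inter_add_sdiff (μ := ν) (fun t => (ENNReal.ofReal (gap t))⁻¹)
      (Set.Ici b) (hGm.inter (measurableSet_Iic (a := s)))
    rw [Set.inter_eq_self_of_subset_right hsub] at hsplit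
    have h0 : ∫⁻ t in Set.Ici b \ (G ∩ Set.Iic s), (ENNReal.ofReal (gap t))⁻¹ ∂ν = 0 := by
      rw [← hsplit] at hsignal
      have h1 := (add_le_add_left (hone s hs) _).trans hsignal
      by_contra hcon
      have h2 : (1 : ENNReal) < 1 + ∫⁻ t in Set.Ici b \ (G ∩ Set.Iic s),
          (ENNReal.ofReal (gap t))⁻¹ ∂ν := ENNReal.lt_add_right ENNReal.one_ne_top hcon
      exact absurd h1 (not_le.2 h2)
    have h1 : (ν Set.univ)⁻¹ * ν (Set.Ici b \ (G ∩ Set.Iic s)) ≤ 0 := by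
      rw [← setLIntegral_const, ← h0]
      refine setLIntegral_mono' (measurableSet_Ici.diff (hGm.inter measurableSet_Iic))
        fun t ht => ?_
      rw [ENNReal.inv_le_inv]
      exact ENNReal.ofReal_le_of_le_toReal
        (P.gramGap_le_traceMeasure_univ measurableSet_Iic (hne t ht.1))
    rcases mul_eq_zero.1 (le_zero_iff.1 h1) with h | h
    · exact absurd h (ENNReal.inv_ne_zero.2 (measure_ne_top _ _))
    · exact h
  have hbdd : BddBelow G := ⟨b, fun t ht => ht.1⟩
  have hbτ : b ≤ sInf G := le_csInf hG fun t ht => ht.1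
  have hatom : ν (Set.Ici b \ {sInf G}) = 0 := by
    obtain ⟨s₀, hs₀⟩ := id hG
    refine measure_null_of_locally_null _ fun r hr => ?_
    -- Points below `inf G` have neighbours outside `G`; a point above it exceeds some `s ∈ G`, so
    -- its neighbours lie outside `(-∞,s]`.
    rcases lt_or_gt_of_ne (show r ≠ sInf G from hr.2) with h | h
    · refine ⟨Set.Ici b \ (G ∩ Set.Iic s₀), ?_, hnull s₀ hs₀⟩
      filter_upwards [self_mem_nhdsWithin, mem_nhdsWithin_of_mem_nhds (Iio_mem_nhds h)]
        with t ht ht'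
      exact ⟨ht.1, fun hc => absurd (csInf_le hbdd hc.1) (not_le.2 ht')⟩
    · obtain ⟨s, hs, hsr⟩ := exists_lt_of_csInf_lt hG h
      refine ⟨Set.Ici b \ (G ∩ Set.Iic s), ?_, hnull s hs⟩
      filter_upwards [self_mem_nhdsWithin, mem_nhdsWithin_of_mem_nhds (Ioi_mem_nhds hsr)]
        with t ht ht'
      exact ⟨ht.1, fun hc => absurd (Set.mem_Iic.1 hc.2) (not_le.2 ht')⟩
  -- Were the infimum not attained, `G ∩ (-∞,s]` would miss the only possible atom and be null.
  have hτ : sInf G ∈ G := by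
    by_contra hcon
    obtain ⟨s, hs⟩ := hG
    have : ν (G ∩ Set.Iic s) = 0 := by
      refine measure_mono_null (?_ : G ∩ Set.Iic s ⊆ Set.Ici b \ {sInf G}) hatom
      intro t ht
      refine ⟨ht.1.1, fun h => hcon ?_⟩
      rw [← Set.mem_singleton_iff.1 h]
      exact ht.1
    have h := hGpos s hs
    rw [measureReal_def, this] at h
    simp at h
  refine ⟨sInf G, hbτ, hatom, hpos _ hbτ, (gramGap_le_of_mem_rankJumpSet hτ).trans ?_⟩
  refine measureReal_mono fun t ht => ?_
  exact le_antisymm ht.2 (csInf_le hbdd ht.1)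

variable (P)

/-- Under the signal condition, the first moment above `b` of a vector in the span of `v` is bounded
by the trace measure weighted with the inverse of the smallest non-zero Gram eigenvalue. -/
theorem integral_Ici_le_of_signal (v : Fin M → E)
    (hid : Integrable (fun t : ℝ => t) (P.traceMeasure v)) {b μ : ℝ} (hμ : μ ≤ b)
    (hb : (fun l => P.proj (Set.Iic b) (v l)) ≠ 0)
    (hsignal : ∫⁻ t in Set.Ici b, (ENNReal.ofReal (P.gramGap v (Set.Iic t)))⁻¹
      ∂P.traceMeasure v ≤ 1) :
    IntegrableOn (fun t => (t - μ) / P.gramGap v (Set.Iic t)) (Set.Ici b) (P.traceMeasure v) ∧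
    ∀ x : EuclideanSpace 𝕜 (Fin M),
      ∫ t in Set.Ici b, (t - μ) ∂P.scalarMeasure (synthesis v x) ≤
        ‖synthesis v x‖ ^ 2 *
          ∫ t in Set.Ici b, (t - μ) / P.gramGap v (Set.Iic t) ∂P.traceMeasure v := by
  rcases (P.rankJumpSet v b).eq_empty_or_nonempty with hG | hG
  · refine P.integral_Ici_le_of_ker_eq v hid hμ hb fun t ht x hx => ?_
    by_contra h0
    exact Set.eq_empty_iff_forall_notMem.1 hG t ⟨ht, x, hx, h0⟩
  obtain ⟨τ, hbτ, hnull, hpos, hle⟩ := exists_atom_of_rankJumpSet_nonempty hb hsignal hG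
  have hrestrict : ∀ m : Measure ℝ, m (Set.Ici b \ {τ}) = 0 →
      m.restrict (Set.Ici b) = m.restrict {τ} := fun m hm =>
    Measure.restrict_congr_set ((ae_le_set.2 hm).antisymm
      (LE.le.eventuallyLE (Set.singleton_subset_iff.2 hbτ)))
  constructor
  · rw [IntegrableOn, hrestrict _ hnull]
    exact integrableOn_singleton
  · intro x
    have hnull' : P.scalarMeasure (synthesis v x) (Set.Ici b \ {τ}) = 0 := by
      have h := P.scalarMeasure_synthesis_le v x (Set.Ici b \ {τ})
      rw [Measure.smul_apply, hnull, smul_zero] at h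
      exact le_zero_iff.1 h
    rw [hrestrict _ hnull, hrestrict _ hnull', integral_singleton, integral_singleton,
      smul_eq_mul, smul_eq_mul]
    have h1 : (P.scalarMeasure (synthesis v x)).real {τ} ≤ ‖synthesis v x‖ ^ 2 := by
      rw [← P.scalarMeasure_real_univ]
      exact measureReal_mono (Set.subset_univ _)
    have h2 : 0 ≤ τ - μ := sub_nonneg.2 (hμ.trans hbτ)
    -- This is `gap ≤ ν{τ}`: the atom's weight is at least 1.
    have h3 : τ - μ ≤ (P.traceMeasure v).real {τ} * ((τ - μ) / P.gramGap v (Set.Iic τ)) := by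
      rw [← mul_div_assoc, le_div_iff₀ hpos, mul_comm]
      gcongr
    gcongr

end ProjectionValuedMeasure

/-! ### Reflection of the spectrum, for the lower bound. -/

namespace ProjectionValuedMeasure

variable {𝕜 E : Type*} [RCLike 𝕜] [NormedAddCommGroup E] [InnerProductSpace 𝕜 E]
  [CompleteSpace E] {M : ℕ} (P : ProjectionValuedMeasure 𝕜 E)

/-- The image of a projection-valued measure under `t ↦ -t`. -/
def reflect : ProjectionValuedMeasure 𝕜 E where
  proj s := P.proj (Neg.neg ⁻¹' s)
  isStarProjection s hs := P.isStarProjection _ (measurable_neg hs)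
  proj_univ := P.proj_univ
  proj_inter s t hs ht := P.proj_inter _ _ (measurable_neg hs) (measurable_neg ht)
  hasSum_iUnion f hf hd x := by
    rw [Set.preimage_iUnion]
    exact P.hasSum_iUnion _ (fun n => measurable_neg (hf n)) (fun i j hij => (hd hij).preimage _) x

theorem reflect_proj (s : Set ℝ) : P.reflect.proj s = P.proj (Neg.neg ⁻¹' s) := rfl

theorem scalarMeasure_reflect (x : E) :
    P.reflect.scalarMeasure x = (P.scalarMeasure x).map Neg.neg := by
  ext s hs
  rw [Measure.map_apply measurable_neg hs, scalarMeasure_apply _ hs,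
    scalarMeasure_apply _ (measurable_neg hs), reflect_proj]

theorem traceMeasure_reflect (v : Fin M → E) :
    P.reflect.traceMeasure v = (P.traceMeasure v).map Neg.neg := by
  ext s hs
  rw [Measure.map_apply measurable_neg hs, traceMeasure_apply _ hs,
    traceMeasure_apply _ (measurable_neg hs), reflect_proj]

theorem gramGap_reflect (v : Fin M → E) (s : Set ℝ) :
    P.reflect.gramGap v s = P.gramGap v (Neg.neg ⁻¹' s) := rfl

theorem _root_.MeasureTheory.Measure.restrict_map_neg_Ici (m : Measure ℝ) (a : ℝ) :
    (m.map Neg.neg).restrict (Set.Ici (-a)) = (m.restrict (Set.Iic a)).map Neg.neg := by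
  rw [Measure.restrict_map measurable_neg measurableSet_Ici]
  congr 2
  ext t
  simp

/-- The reflected form of `integral_Ici_le_of_signal`. -/
theorem le_integral_Iic_of_signal (v : Fin M → E)
    (hid : Integrable (fun t : ℝ => t) (P.traceMeasure v)) {a μ : ℝ} (hμ : a ≤ μ)
    (ha : (fun l => P.proj (Set.Ici a) (v l)) ≠ 0)
    (hsignal : ∫⁻ t in Set.Iic a, (ENNReal.ofReal (P.gramGap v (Set.Ici t)))⁻¹
      ∂P.traceMeasure v ≤ 1) :
    IntegrableOn (fun t => (t - μ) / P.gramGap v (Set.Ici t)) (Set.Iic a) (P.traceMeasure v) ∧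
    ∀ x : EuclideanSpace 𝕜 (Fin M),
      ‖synthesis v x‖ ^ 2 *
          ∫ t in Set.Iic a, (t - μ) / P.gramGap v (Set.Ici t) ∂P.traceMeasure v ≤
        ∫ t in Set.Iic a, (t - μ) ∂P.scalarMeasure (synthesis v x) := by
  have hemb : MeasurableEmbedding (Neg.neg : ℝ → ℝ) := (MeasurableEquiv.neg ℝ).measurableEmbedding
  have hgap : ∀ t : ℝ, P.reflect.gramGap v (Set.Iic (-t)) = P.gramGap v (Set.Ici t) := by
    intro t
    rw [gramGap_reflect]
    congr 1
    ext r
    simp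
  have hfun : ∀ t : ℝ, -t - -μ = -(t - μ) := fun t => by ring
  have h := P.reflect.integral_Ici_le_of_signal v (b := -a) (μ := -μ) ?_ (neg_le_neg hμ) ?_ ?_
  · simp only [IntegrableOn, traceMeasure_reflect, scalarMeasure_reflect,
      Measure.restrict_map_neg_Ici, hemb.integrable_map_iff, hemb.integral_map,
      Function.comp_def, hgap, hfun, neg_div, integrable_fun_neg_iff, integral_neg] at h
    refine ⟨h.1, fun x => ?_⟩
    have := h.2 x
    linarith
  · rw [traceMeasure_reflect, hemb.integrable_map_iff]
    exact hid.neg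
  · have hpre : (Neg.neg ⁻¹' Set.Iic (-a) : Set ℝ) = Set.Ici a := by
      ext r
      simp
    rwa [reflect_proj, hpre]
  · rw [traceMeasure_reflect, Measure.restrict_map_neg_Ici, hemb.lintegral_map]
    simpa only [hgap] using hsignal

end ProjectionValuedMeasure

/-! ### Assembly of the two inequalities. -/

section Main

variable {𝕜 E : Type*} [RCLike 𝕜] [NormedAddCommGroup E] [InnerProductSpace 𝕜 E]
  [CompleteSpace E] {M : ℕ} {H : E →ₗ.[𝕜] E} {P : ProjectionValuedMeasure 𝕜 E}

theorem coe_linearCombination_projectedGuess (hP : IsSpectralResolution H P) (v : Fin M → H.domain)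
    {I : Set ℝ} (hI : MeasurableSet I) (z : Fin M → 𝕜) :
    (Fintype.linearCombination 𝕜 (projectedGuess hP v I hI) z : E) =
      P.proj I (Fintype.linearCombination 𝕜 v z : E) := by
  simp [Fintype.linearCombination_apply, projectedGuess]

theorem rank_gramMatrix_projectedGuess_le (hP : IsSpectralResolution H P) (v : Fin M → H.domain)
    {I : Set ℝ} (hI : MeasurableSet I) :
    (gramMatrix (projectedGuess hP v I hI)).rank ≤ (gramMatrix v).rank := by
  have h1 := (Fintype.linearCombination 𝕜 v).finrank_range_add_finrank_ker
  have h2 := (Fintype.linearCombination 𝕜 (projectedGuess hP v I hI)).finrank_range_add_finrank_ker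
  have h3 : LinearMap.ker (Fintype.linearCombination 𝕜 v) ≤
      LinearMap.ker (Fintype.linearCombination 𝕜 (projectedGuess hP v I hI)) := by
    intro z hz
    rw [LinearMap.mem_ker] at hz ⊢
    ext
    rw [coe_linearCombination_projectedGuess, hz]
    simp
  have h4 := Submodule.finrank_mono h3
  rw [rank_gramMatrix, rank_gramMatrix]
  omega

namespace IsSpectralResolution

theorem integrable_id (hP : IsSpectralResolution H P) (x : H.domain) :
    Integrable (fun t : ℝ => t) (P.scalarMeasure (x : E)) := by
  refine Integrable.mono' (((hP.mem_domain_iff _).1 x.2).add (integrable_const 1))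
    measurable_id.aestronglyMeasurable (ae_of_all _ fun t => ?_)
  simp only [Real.norm_eq_abs, Pi.add_apply]
  nlinarith [sq_abs t, sq_nonneg (|t| - 1)]

theorem integrable_id_traceMeasure (hP : IsSpectralResolution H P) (v : Fin M → H.domain) :
    Integrable (fun t : ℝ => t) (P.traceMeasure fun l => (v l : E)) :=
  integrable_finsetSum_measure.2 fun l _ => hP.integrable_id (v l)

theorem re_inner_apply (hP : IsSpectralResolution H P) (x : H.domain) :
    RCLike.re (inner 𝕜 (x : E) (H x)) = ∫ t, t ∂P.scalarMeasure (x : E) := by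
  rw [hP.inner_apply, RCLike.ofReal_re]

theorem re_inner_linearCombination_projectedGuess (hP : IsSpectralResolution H P)
    (v : Fin M → H.domain) {I : Set ℝ} (hI : MeasurableSet I) (z : Fin M → 𝕜) :
    RCLike.re (inner 𝕜 (Fintype.linearCombination 𝕜 (projectedGuess hP v I hI) z : E)
      (H (Fintype.linearCombination 𝕜 (projectedGuess hP v I hI) z))) =
      ∫ t in I, t ∂P.scalarMeasure (Fintype.linearCombination 𝕜 v z : E) := by
  rw [hP.re_inner_apply, coe_linearCombination_projectedGuess, P.scalarMeasure_proj hI]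

theorem norm_linearCombination_projectedGuess_sq (hP : IsSpectralResolution H P)
    (v : Fin M → H.domain) {I : Set ℝ} (hI : MeasurableSet I) (z : Fin M → 𝕜) :
    ‖(Fintype.linearCombination 𝕜 (projectedGuess hP v I hI) z : E)‖ ^ 2 =
      (P.scalarMeasure (Fintype.linearCombination 𝕜 v z : E)).real I := by
  rw [coe_linearCombination_projectedGuess, P.scalarMeasure_real hI]

end IsSpectralResolution

/-- The middle term is kept as the quadratic form of `B` minus `μ` times its norm squared, so that
`exists_rayleigh_bounds` decides its sign. -/
theorem integral_sub_const_eq_add_add {m : Measure ℝ} [IsFiniteMeasure m]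
    (hm : Integrable (fun t : ℝ => t) m) {a b : ℝ} (hab : a < b) (μ : ℝ) :
    ∫ t, t ∂m - μ * m.real Set.univ = ∫ t in Set.Iic a, (t - μ) ∂m +
      (∫ t in Set.Ioo a b, t ∂m - μ * m.real (Set.Ioo a b)) + ∫ t in Set.Ici b, (t - μ) ∂m := by
  have hf : Integrable (fun t : ℝ => t - μ) m := hm.sub (integrable_const μ)
  have h1 : ∫ t, (t - μ) ∂m = ∫ t, t ∂m - μ * m.real Set.univ := by
    rw [integral_sub hm (integrable_const μ), integral_const, smul_eq_mul, mul_comm]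
  have h2 : ∫ t in Set.Ioo a b, (t - μ) ∂m =
      ∫ t in Set.Ioo a b, t ∂m - μ * m.real (Set.Ioo a b) := by
    rw [integral_sub hm.integrableOn (integrable_const μ), setIntegral_const, smul_eq_mul, mul_comm]
  have hdisj : Disjoint (Set.Ioo a b) (Set.Ici b) :=
    Set.disjoint_left.2 fun t ht ht' => not_le.2 ht.2 (Set.mem_Ici.1 ht')
  rw [← h1, ← h2, ← integral_add_compl (measurableSet_Iic (a := a)) hf, add_assoc, Set.compl_Iic,
    ← Set.Ioo_union_Ici_eq_Ioi hab,
    setIntegral_union hdisj measurableSet_Ici hf.integrableOn hf.integrableOn]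

end Main

theorem mainTheorem7 {𝕜 E : Type*} [RCLike 𝕜] [NormedAddCommGroup E] [InnerProductSpace 𝕜 E]
    [CompleteSpace E] {M : ℕ}
    (H : E →ₗ.[𝕜] E) (P : ProjectionValuedMeasure 𝕜 E) (hP : IsSpectralResolution H P)
    (v : Fin M → H.domain) (Ea Eb : ℝ) (hsignal : IsSignal hP v Ea Eb)
    (B : Fin M → H.domain) (hB : B = projectedGuess hP v (Set.Ioo Ea Eb) measurableSet_Ioo)
    (μV μB : ℕ → ℝ) (hμV : IsProperEigenvalues H v μV) (hμB : IsProperEigenvalues H B μB)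
    (i : ℕ) (hi : i < (gramMatrix B).rank) :
    (IntegrableOn (fun t => (t - μB i) / lambdaUp hP v t) (Set.Ici Eb) (spectralMeasure P v) ∧
      μV i - μB i ≤
        ∫ t in Set.Ici Eb, (t - μB i) / lambdaUp hP v t ∂spectralMeasure P v) ∧
    (IntegrableOn (fun t => (t - μB i) / lambdaDown hP v t) (Set.Iic Ea) (spectralMeasure P v) ∧
      ∫ t in Set.Iic Ea, (t - μB i) / lambdaDown hP v t ∂spectralMeasure P v ≤
        μV i - μB i) := by
  subst hB
  have hiV := hi.trans_le (rank_gramMatrix_projectedGuess_le hP v measurableSet_Ioo)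
  have hpos : ∀ z : Fin M → 𝕜,
      Fintype.linearCombination 𝕜 (projectedGuess hP v (Set.Ioo Ea Eb) measurableSet_Ioo) z ≠ 0 →
      0 < (P.scalarMeasure (Fintype.linearCombination 𝕜 v z : E)).real (Set.Ioo Ea Eb) := by
    intro z hz
    rw [← hP.norm_linearCombination_projectedGuess_sq v measurableSet_Ioo]
    have : (Fintype.linearCombination 𝕜
        (projectedGuess hP v (Set.Ioo Ea Eb) measurableSet_Ioo) z : E) ≠ 0 := by simpa using hz
    positivity
  have hbounds : Ea < Eb ∧ Ea ≤ μB i ∧ μB i ≤ Eb ∧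
      (fun l => P.proj (Set.Ioo Ea Eb) (v l : E)) ≠ 0 := by
    -- Comparing `B` with itself yields a vector with Rayleigh quotient exactly `μB i`, an average
    -- of `t` over `(Ea, Eb)`.
    obtain ⟨z, hz, h1, h2⟩ := exists_rayleigh_bounds hμB hμB hi hi
    have hm := hpos z hz
    rw [hP.re_inner_linearCombination_projectedGuess,
      hP.norm_linearCombination_projectedGuess_sq] at h1 h2
    set m := P.scalarMeasure (Fintype.linearCombination 𝕜 v z : E)
    have hid := (hP.integrable_id (Fintype.linearCombination 𝕜 v z)).integrableOn
      (s := Set.Ioo Ea Eb)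
    have hlow : Ea * m.real (Set.Ioo Ea Eb) ≤ ∫ t in Set.Ioo Ea Eb, t ∂m := by
      have := setIntegral_mono_on (integrable_const Ea) hid measurableSet_Ioo fun t ht => ht.1.le
      rwa [setIntegral_const, smul_eq_mul, mul_comm] at this
    have hupp : ∫ t in Set.Ioo Ea Eb, t ∂m ≤ Eb * m.real (Set.Ioo Ea Eb) := by
      have := setIntegral_mono_on hid (integrable_const Eb) measurableSet_Ioo fun t ht => ht.2.le
      rwa [setIntegral_const, smul_eq_mul, mul_comm] at this
    refine ⟨?_, le_of_mul_le_mul_right (hlow.trans h2) hm,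
      le_of_mul_le_mul_right (h1.trans hupp) hm, fun h0 => hz ?_⟩
    · by_contra hab
      rw [Set.Ioo_eq_empty hab] at hm
      simp at hm
    · have : projectedGuess hP v (Set.Ioo Ea Eb) measurableSet_Ioo = 0 := by
        ext l
        exact congrFun h0 l
      rw [this]
      simp [Fintype.linearCombination_apply]
  obtain ⟨hab, haμ, hμb, hne⟩ := hbounds
  -- `lambdaUp`, `lambdaDown` and `spectralMeasure` unfold to `gramGap` and `traceMeasure`, so the
  -- signal hypotheses apply as they stand.
  have hup := P.integral_Ici_le_of_signal (fun l => (v l : E)) (hP.integrable_id_traceMeasure v)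
    hμb (ProjectionValuedMeasure.proj_ne_zero_of_subset measurableSet_Ioo measurableSet_Iic
      (fun t ht => ht.2.le) hne) hsignal.upper
  have hdown := P.le_integral_Iic_of_signal (fun l => (v l : E)) (hP.integrable_id_traceMeasure v)
    haμ (ProjectionValuedMeasure.proj_ne_zero_of_subset measurableSet_Ioo measurableSet_Ici
      (fun t ht => ht.1.le) hne) hsignal.lower
  refine ⟨⟨hup.1, ?_⟩, hdown.1, ?_⟩
  · obtain ⟨z, hz, h1, h2⟩ := exists_rayleigh_bounds hμV hμB hiV hi
    have h3 := hup.2 (WithLp.toLp 2 z)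
    rw [hP.re_inner_linearCombination_projectedGuess,
      hP.norm_linearCombination_projectedGuess_sq] at h2
    rw [hP.re_inner_apply] at h1
    rw [← coe_linearCombination_eq_synthesis] at h3
    have hsplit := integral_sub_const_eq_add_add
      (hP.integrable_id (Fintype.linearCombination 𝕜 v z)) hab (μB i)
    rw [P.scalarMeasure_real_univ] at hsplit
    have hlow : ∫ t in Set.Iic Ea, (t - μB i)
        ∂P.scalarMeasure (Fintype.linearCombination 𝕜 v z : E) ≤ 0 :=
      setIntegral_nonpos measurableSet_Iic fun t ht => sub_nonpos.2 (le_trans ht haμ)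
    have hn : 0 < ‖(Fintype.linearCombination 𝕜 v z : E)‖ ^ 2 := by
      have : (Fintype.linearCombination 𝕜 v z : E) ≠ 0 := by simpa using hz
      positivity
    refine le_of_mul_le_mul_left (le_trans ?_ h3) hn
    linarith
  -- The roles are exchanged: `z` is now high for `B` and low for `V`, so the part over `(Ea, Eb)`
  -- and the part above `Eb` are both nonnegative.
  · obtain ⟨z, hz, h1, h2⟩ := exists_rayleigh_bounds hμB hμV hi hiV
    have h3 := hdown.2 (WithLp.toLp 2 z)
    have hm := hpos z hz
    rw [hP.re_inner_linearCombination_projectedGuess,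
      hP.norm_linearCombination_projectedGuess_sq] at h1
    rw [hP.re_inner_apply] at h2
    rw [← coe_linearCombination_eq_synthesis] at h3
    have hsplit := integral_sub_const_eq_add_add
      (hP.integrable_id (Fintype.linearCombination 𝕜 v z)) hab (μB i)
    rw [P.scalarMeasure_real_univ] at hsplit
    have hupp : 0 ≤ ∫ t in Set.Ici Eb, (t - μB i)
        ∂P.scalarMeasure (Fintype.linearCombination 𝕜 v z : E) :=
      setIntegral_nonneg measurableSet_Ici fun t ht => sub_nonneg.2 (hμb.trans ht)
    have hn : 0 < ‖(Fintype.linearCombination 𝕜 v z : E)‖ ^ 2 := by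
      rw [← P.scalarMeasure_real_univ]
      exact hm.trans_le (measureReal_mono (Set.subset_univ _))
    refine le_of_mul_le_mul_left (h3.trans ?_) hn
    linarith
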